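/- Consider a finite set $J$ of jobs to be scheduled preemptively on a single machine of speed $1$; job $j$ has processing time $p_j>0$ and release date $r_j\ge 0$. A schedule assigns to the jobs measurable processing rates that are nonnegative, sum to at most $1$ at any time, and vanish for $j$ before $r_j$; $y_j(t)\le p_j$ is the processing that $j$ has received until time $t$, $p_j(t)=p_j-y_j(t)$ is its remaining processing time, and its completion time $C_j$ is the earliest time $t$ with $y_j(t)=p_j$ ($C_j=\infty$ if there is none). A job $j$ is available at time $t$ if $r_j\le t<C_j$. The total flow time is $\sum_{j}(C_j-r_j)$. Let $0<\alpha<1$. Given a schedule, let $N(t)$ be the set of jobs $j$ available at time $t$ with $y_j(t)\le\alpha p_j$, let $C(t)$ be the set of jobs $j$ available at time $t$ with $y_j(t)>\alpha p_j$ (the available jobs that have already emitted their signal), and let $s_j$ be the earliest time $t\ge r_j$ with $y_j(t)=\alpha p_j$. Consider a schedule that follows, at almost every time $t$, this rule (where $\min\emptyset=\infty$; if no job is available, the machine idles): 1. If $\min_{j\in C(t)}p_j(t)\le\frac{1-\alpha}{\alpha}\min_{j\in N(t)}y_j(t)$, process at rate $1$ a job of $C(t)$ with smallest remaining processing time $p_j(t)$,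 choosing among these one with largest $s_j$ and breaking the remaining ties arbitrarily. 2. Otherwise, process all jobs of $N(t)$ with smallest $y_j(t)$ at the same rate, the rates summing to $1$. Fix any schedule of minimum total flow time for the same instance, and let $O(t)$ be the set of jobs available at time $t$ in it. Then at any time $t$, $$|C(t)\setminus O(t)|\le\Big(1+\frac{1}{1-\alpha}\Big)\cdot|O(t)|,$$ where $C(t)$ refers to the schedule of the rule above. -/

import Mathlib

open MeasureTheory

noncomputable section

namespace FlowTime

/-- A single-machine instance with job set `J`: processing times and release dates. -/
structure FlowInstance (J : Type*) where
  p : J → ℝ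
  r : J → ℝ
  p_pos : ∀ j, 0 < p j
  r_nonneg : ∀ j, 0 ≤ r j

/-- A preemptive schedule on one machine of speed 1, given by the rates at which the jobs are
processed at each time. A job is processed only from its release date on, and it never receives
more processing than its processing time. -/
structure Schedule {J : Type*} [Fintype J] (I : FlowInstance J) where
  rate : J → ℝ → ℝ
  measurable_rate : ∀ j, Measurable (rate j)
  rate_nonneg : ∀ j t, 0 ≤ rate j t
  sum_rate_le_one : ∀ t, ∑ j, rate j t ≤ 1
  rate_eq_zero_of_lt_release : ∀ j t, t < I.r j → rate j t = 0
  work_le : ∀ j t, ∫ u in (0 : ℝ)..t, rate j u ≤ I.p j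

namespace Schedule

variable {J : Type*} [Fintype J] {I : FlowInstance J} (S : Schedule I)

/-- The amount of processing `y_j(t)` that `j` has received until time `t`. -/
def y (j : J) (t : ℝ) : ℝ := ∫ u in (0 : ℝ)..t, S.rate j u

/-- The remaining processing time `p_j(t) = p_j - y_j(t)`. -/
def remaining (j : J) (t : ℝ) : ℝ := I.p j - S.y j t

/-- The completion time `C_j`, the earliest time at which `j` has received its whole processing
time; it is `⊤` if `j` is never completed. -/
def completionTime (j : J) : EReal := ⨅ (t : ℝ) (_ : I.p j ≤ S.y j t), (t : EReal)

/-- The total flow time `∑ (C_j - r_j)`. -/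
def totalFlowTime : EReal := ∑ j, (S.completionTime j - (I.r j : EReal))

/-- The schedule has minimum total flow time among all schedules of the instance. -/
def IsOptimal : Prop := ∀ S' : Schedule I, S.totalFlowTime ≤ S'.totalFlowTime

/-- The available jobs `{j | r_j ≤ t < C_j}`. -/
def available (t : ℝ) : Set J := {j | I.r j ≤ t ∧ (t : EReal) < S.completionTime j}

/-- The available jobs with `y_j(t) ≤ α p_j`. -/
def nonclairvoyant (α t : ℝ) : Set J := {j | j ∈ S.available t ∧ S.y j t ≤ α * I.p j}

/-- The available jobs with `y_j(t) > α p_j`. -/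
def clairvoyant (α t : ℝ) : Set J := {j | j ∈ S.available t ∧ α * I.p j < S.y j t}

/-- The time `s_j` at which `j` emits its signal: the earliest time (from the release date on)
with `y_j = α p_j`. It is only used for clairvoyant jobs, for which such a time exists. -/
def signalTime (α : ℝ) (j : J) : ℝ := sInf {t | I.r j ≤ t ∧ S.y j t = α * I.p j}

/-- `min_{j ∈ C(t)} p_j(t) ≤ ((1 - α) / α) * min_{i ∈ N(t)} y_i(t)`, a minimum over the empty set
being `∞`, at a time at which `C(t)` is nonempty. -/
def SRPTCondition (α t : ℝ) : Prop :=
  ∃ j ∈ S.clairvoyant α t, ∀ i ∈ S.nonclairvoyant α t,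
    S.remaining j t ≤ (1 - α) / α * S.y i t

/-- The clairvoyant jobs of smallest remaining processing time, and among these the ones that
emitted last. -/
def srptCandidates (α t : ℝ) : Set J :=
  {k | k ∈ S.clairvoyant α t ∧ ∀ j ∈ S.clairvoyant α t,
    S.remaining k t ≤ S.remaining j t ∧
      (S.remaining j t = S.remaining k t → S.signalTime α j ≤ S.signalTime α k)}

/-- The nonclairvoyant jobs that have received the smallest amount of processing so far. -/
def setfJobs (α t : ℝ) : Set J :=
  {k | k ∈ S.nonclairvoyant α t ∧ ∀ j ∈ S.nonclairvoyant α t, S.y k t ≤ S.y j t}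

/-- The schedule is one of the algorithm (for some way of breaking the remaining ties): at almost
every time, under the first rule one candidate is processed at rate 1 and nothing else, and
otherwise exactly the jobs of `setfJobs` are processed, at equal rates that sum to 1. (If no job is
available, the second clause says that the machine idles.) -/
def FollowsAlgorithm (α : ℝ) : Prop :=
  ∀ᵐ t : ℝ,
    (S.SRPTCondition α t →
      ∃ k ∈ S.srptCandidates α t, S.rate k t = 1 ∧ ∀ j, j ≠ k → S.rate j t = 0) ∧
    (¬ S.SRPTCondition α t →
      (∀ j ∈ S.setfJobs α t, S.rate j t = 1 / ((S.setfJobs α t).ncard : ℝ)) ∧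
      ∀ j, j ∉ S.setfJobs α t → S.rate j t = 0)

end Schedule

end FlowTime

end

/-! Let `D` be the set on the left, `R c` the remaining time of `c ∈ D` at time `t`, and `τ c` the
last time up to `t` at which `c` was processed. On the window `[τ c, t]` the clairvoyant job `c`
waits, so the machine never idles. By `y_eq_of_release_lt`, every other unfinished job released
before `τ c` is frozen on the window and has remaining time above `R c`. Hence the values `R c` are
distinct, and if `R d < R c` then `τ c ≤ r d < τ d`: the windows grow with `R`.

All work in the window goes to jobs released in it, so the rule does at least as much work on these
jobs as the optimum. The jobs of `D` released there are finished in the optimum, so their total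
remaining time is at most the work the rule has spent on jobs of `O(t)` released there
(`sum_remaining_le_window`). By `y_mul_le_remaining` each such job has received at most `R c / (1 -
α)`.

Now order `D` by increasing `R`, and let `V k` be the jobs of `O(t)` released in the `k`-th window.
Indices at which the next window brings a new job of `O(t)` number at most `|O(t)|`. The others are
paid for by volume, at most `1 / (1 - α)` of them per job of `O(t)` (`le_mul_card_of_chain`). -/

namespace FlowTime

namespace Schedule

variable {J : Type*} [Fintype J] {I : FlowInstance J} (S : Schedule I)

/-! ### Work functions, completion and availability -/

section Basic

lemma rate_le_one (j : J) (t : ℝ) : S.rate j t ≤ 1 :=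
  (Finset.single_le_sum (f := fun i => S.rate i t) (fun i _ => S.rate_nonneg i t)
    (Finset.mem_univ j)).trans (S.sum_rate_le_one t)

lemma locallyIntegrable_rate (j : J) : LocallyIntegrable (S.rate j) volume := by
  refine (locallyIntegrable_const (1 : ℝ)).mono (S.measurable_rate j).aestronglyMeasurable ?_
  filter_upwards with t
  rw [Real.norm_of_nonneg (S.rate_nonneg j t), norm_one]
  exact S.rate_le_one j t

lemma intervalIntegrable_rate (j : J) (a b : ℝ) : IntervalIntegrable (S.rate j) volume a b :=
  intervalIntegrable_iff.2 (((S.locallyIntegrable_rate j).integrableOn_isCompact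
    isCompact_uIcc).mono_set Set.uIoc_subset_uIcc)

lemma y_sub_y (j : J) (a b : ℝ) : S.y j b - S.y j a = ∫ u in a..b, S.rate j u :=
  intervalIntegral.integral_interval_sub_left (S.intervalIntegrable_rate j _ _)
    (S.intervalIntegrable_rate j _ _)

lemma monotone_y (j : J) : Monotone (S.y j) := fun a b hab => by
  have h := S.y_sub_y j a b
  have := intervalIntegral.integral_nonneg (μ := volume) hab (fun u _ => S.rate_nonneg j u)
  linarith

lemma continuous_y (j : J) : Continuous (S.y j) :=
  intervalIntegral.continuous_primitive (S.intervalIntegrable_rate j) 0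

lemma y_le (j : J) (t : ℝ) : S.y j t ≤ I.p j := S.work_le j t

lemma y_eq_of_ae_rate_eq_zero {j : J} {a b : ℝ} (hab : a ≤ b)
    (h : ∀ᵐ u : ℝ, a < u → u ≤ b → S.rate j u = 0) : S.y j b = S.y j a := by
  have h0 : ∫ u in a..b, S.rate j u = 0 := by
    apply intervalIntegral.integral_zero_ae
    filter_upwards [h] with u hu hmem
    rw [Set.uIoc_of_le hab] at hmem
    exact hu hmem.1 hmem.2
  linarith [S.y_sub_y j a b]

lemma y_eq_zero {j : J} {t : ℝ} (ht : t ≤ I.r j) : S.y j t = 0 := by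
  have hne : ∀ᵐ u : ℝ, u ≠ I.r j := by simp [ae_iff, measure_singleton]
  have h0 : S.y j 0 = 0 := by simp [y]
  rcases le_total 0 t with h | h
  · rw [← h0]
    apply S.y_eq_of_ae_rate_eq_zero h
    filter_upwards [hne] with u hu _ hut
    exact S.rate_eq_zero_of_lt_release j u (lt_of_le_of_ne (hut.trans ht) hu)
  · rw [← h0]
    refine (S.y_eq_of_ae_rate_eq_zero h ?_).symm
    filter_upwards [hne] with u hu _ hut
    exact S.rate_eq_zero_of_lt_release j u (lt_of_le_of_ne (hut.trans (I.r_nonneg j)) hu)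

lemma y_nonneg (j : J) (t : ℝ) : 0 ≤ S.y j t := by
  rcases le_total t (I.r j) with h | h
  · exact (S.y_eq_zero h).ge
  · rw [← S.y_eq_zero (le_refl (I.r j))]
    exact S.monotone_y j h

lemma release_lt_of_y_pos {j : J} {t : ℝ} (h : 0 < S.y j t) : I.r j < t := by
  by_contra! hle
  exact h.ne' (S.y_eq_zero hle)

/-- By continuity an unfinished job stays unfinished slightly beyond `t`, so the infimum is strictly
larger than `t`. -/
lemma lt_completionTime_iff (j : J) (t : ℝ) :
    (t : EReal) < S.completionTime j ↔ S.y j t < I.p j := by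
  constructor
  · intro h
    by_contra! hle
    exact h.not_ge (iInf₂_le t hle)
  · intro h
    obtain ⟨ε, hε, hball⟩ := Metric.eventually_nhds_iff.1
      ((S.continuous_y j).continuousAt.eventually_lt (continuousAt_const (y := I.p j)) h)
    have hlt : S.y j (t + ε / 2) < I.p j := by
      apply hball
      rw [Real.dist_eq, add_sub_cancel_left, abs_of_pos (by linarith)]
      linarith
    have h1 : (t : EReal) < ((t + ε / 2 : ℝ) : EReal) := by
      exact_mod_cast (by linarith : t < t + ε / 2)
    refine h1.trans_le (le_iInf₂ fun u hu => ?_)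
    rw [EReal.coe_le_coe_iff]
    by_contra! hu'
    linarith [S.monotone_y j hu'.le]

lemma mem_available_iff {j : J} {t : ℝ} :
    j ∈ S.available t ↔ I.r j ≤ t ∧ S.y j t < I.p j := by
  simp [available, lt_completionTime_iff]

lemma mem_clairvoyant_iff {α t : ℝ} {j : J} :
    j ∈ S.clairvoyant α t ↔ (I.r j ≤ t ∧ S.y j t < I.p j) ∧ α * I.p j < S.y j t := by
  simp [clairvoyant, mem_available_iff]

lemma mem_nonclairvoyant_iff {α t : ℝ} {j : J} :
    j ∈ S.nonclairvoyant α t ↔ (I.r j ≤ t ∧ S.y j t < I.p j) ∧ S.y j t ≤ α * I.p j := by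
  simp [nonclairvoyant, mem_available_iff]

lemma sum_y_sub_le {a b : ℝ} (hab : a ≤ b) (s : Finset J) :
    ∑ j ∈ s, (S.y j b - S.y j a) ≤ b - a := by
  simp_rw [y_sub_y]
  rw [← intervalIntegral.integral_finsetSum fun j _ => S.intervalIntegrable_rate j a b]
  calc ∫ u in a..b, ∑ j ∈ s, S.rate j u ≤ ∫ _ in a..b, (1 : ℝ) := by
        apply intervalIntegral.integral_mono_on hab _ (by simp)
        · intro u _
          exact (Finset.sum_le_univ_sum_of_nonneg fun j => S.rate_nonneg j u).trans
            (S.sum_rate_le_one u)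
        · simpa [Finset.sum_fn] using
            IntervalIntegrable.sum s fun j _ => S.intervalIntegrable_rate j a b
    _ = b - a := by simp

lemma sum_y_sub_eq {a b : ℝ} (hab : a ≤ b)
    (h : ∀ᵐ u : ℝ, a < u → u ≤ b → ∑ j, S.rate j u = 1) :
    ∑ j, (S.y j b - S.y j a) = b - a := by
  simp_rw [y_sub_y]
  rw [← intervalIntegral.integral_finsetSum fun j _ => S.intervalIntegrable_rate j a b]
  have : ∫ u in a..b, ∑ j, S.rate j u = ∫ _ in a..b, (1 : ℝ) := by
    apply intervalIntegral.integral_congr_ae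
    filter_upwards [h] with u hu hmem
    rw [Set.uIoc_of_le hab] at hmem
    exact hu hmem.1 hmem.2
  rw [this]
  simp

/-- A job that is not processed while it has received less than `L` never leaves a level
below `L`. -/
lemma y_eq_of_ae_rate_eq_zero_of_lt {j : J} {a b L : ℝ} (hab : a ≤ b) (ha : S.y j a < L)
    (h : ∀ᵐ u : ℝ, a < u → u ≤ b → S.y j u < L → S.rate j u = 0) : S.y j b = S.y j a := by
  by_contra hne
  have hlt : S.y j a < S.y j b := lt_of_le_of_ne (S.monotone_y j hab) (Ne.symm hne)
  -- Until the work first reaches an intermediate level `ℓ < L` the rate vanishes, so that level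
  -- cannot be reached.
  obtain ⟨ℓ, hℓ1, hℓ2⟩ := exists_between (lt_min hlt ha)
  obtain ⟨v, hv, hvℓ⟩ := intermediate_value_Icc hab (S.continuous_y j).continuousOn
    ⟨hℓ1.le, (hℓ2.trans_le (min_le_left _ _)).le⟩
  have : S.y j v = S.y j a := by
    apply S.y_eq_of_ae_rate_eq_zero hv.1
    filter_upwards [h] with u hu hau huv
    refine hu hau (huv.trans hv.2) ?_
    have := S.monotone_y j huv
    linarith [min_le_right (S.y j b) L]
  linarith

/-- If `j` is processed during `(a, b]`, then it is processed at some time there at which a given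
almost sure property holds. -/
lemma exists_rate_pos {j : J} {a b : ℝ} (hab : a ≤ b) (hlt : S.y j a < S.y j b) {Q : ℝ → Prop}
    (hQ : ∀ᵐ u : ℝ, Q u) : ∃ u, a < u ∧ u < b ∧ 0 < S.rate j u ∧ Q u := by
  by_contra! hno
  have hne : ∀ᵐ u : ℝ, u ≠ b := by simp [ae_iff, measure_singleton]
  refine hlt.ne' (S.y_eq_of_ae_rate_eq_zero hab ?_)
  filter_upwards [hQ, hne] with u hu hub hau hle
  by_contra h0
  exact hno u hau (lt_of_le_of_ne hle hub) (lt_of_le_of_ne (S.rate_nonneg j u) (Ne.symm h0)) hu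

/-- The last time before `t` at which `j` has been processed. -/
noncomputable def lastProcessed (t : ℝ) (j : J) : ℝ := sInf {u | S.y j u = S.y j t}

/-- Positivity bounds the set below by the release date; if `y j t = 0` the set is unbounded below
and `sInf` is a default value. -/
lemma lastProcessed_spec {t : ℝ} {j : J} (h : 0 < S.y j t) :
    S.lastProcessed t j ≤ t ∧ S.y j (S.lastProcessed t j) = S.y j t ∧
      ∀ u < S.lastProcessed t j, S.y j u < S.y j t := by
  have hbdd : BddBelow {u | S.y j u = S.y j t} :=
    ⟨I.r j, fun u (hu : S.y j u = S.y j t) => (S.release_lt_of_y_pos (hu ▸ h)).le⟩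
  have hclosed : IsClosed {u | S.y j u = S.y j t} :=
    isClosed_eq (S.continuous_y j) continuous_const
  have hle : S.lastProcessed t j ≤ t := csInf_le hbdd rfl
  refine ⟨hle, hclosed.csInf_mem ⟨t, rfl⟩ hbdd, fun u hu => ?_⟩
  exact lt_of_le_of_ne (S.monotone_y j (hu.le.trans hle)) fun he => hu.not_ge (csInf_le hbdd he)

end Basic

/-! ### Pointwise consequences of the rule -/

section Rule

/-- The rule of the algorithm at time `t`. -/
def RuleAt (α t : ℝ) : Prop :=
  (S.SRPTCondition α t →
      ∃ k ∈ S.srptCandidates α t, S.rate k t = 1 ∧ ∀ j, j ≠ k → S.rate j t = 0) ∧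
    (¬ S.SRPTCondition α t →
      (∀ j ∈ S.setfJobs α t, S.rate j t = 1 / ((S.setfJobs α t).ncard : ℝ)) ∧
      ∀ j, j ∉ S.setfJobs α t → S.rate j t = 0)

variable {S} {α u : ℝ}

/-- What the rule says about a clairvoyant job that is being processed. -/
lemma RuleAt.of_clairvoyant_rate_pos (hα0 : 0 < α) (h : S.RuleAt α u) {c : J}
    (hc : α * I.p c < S.y c u) (hpos : 0 < S.rate c u) :
    S.rate c u = 1 ∧ (∀ j, j ≠ c → S.rate j u = 0) ∧
      ∀ i ∈ S.nonclairvoyant α u, α * S.remaining c u ≤ (1 - α) * S.y i u := by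
  by_cases hs : S.SRPTCondition α u
  · obtain ⟨k, hk, hk1, hk0⟩ := h.1 hs
    obtain rfl : c = k := by
      by_contra hne
      exact hpos.ne' (hk0 c hne)
    refine ⟨hk1, hk0, fun i hi => ?_⟩
    obtain ⟨j, hj, hji⟩ := hs
    have h1 := ((hk.2 j hj).1).trans (hji i hi)
    rw [div_mul_eq_mul_div, le_div_iff₀ hα0] at h1
    linarith
  · have := (h.2 hs).2 c fun hmem => hc.not_ge hmem.1.2
    exact absurd this hpos.ne'

/-- What the rule says about a job that is being processed while `c` is clairvoyant. -/
lemma RuleAt.of_rate_pos (hα0 : 0 < α) (hα1 : α < 1) (h : S.RuleAt α u) {c j : J}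
    (hc : c ∈ S.clairvoyant α u) (hpos : 0 < S.rate j u) :
    S.remaining j u ≤ S.remaining c u ∨
      S.y j u ≤ α * I.p j ∧ (1 - α) * S.y j u < α * S.remaining c u := by
  by_cases hs : S.SRPTCondition α u
  · obtain ⟨k, hk, hk1, hk0⟩ := h.1 hs
    obtain rfl : j = k := by
      by_contra hne
      exact hpos.ne' (hk0 j hne)
    exact Or.inl (hk.2 c hc).1
  · have hmem : j ∈ S.setfJobs α u := by
      by_contra hmem
      exact hpos.ne' ((h.2 hs).2 j hmem)
    refine Or.inr ⟨hmem.1.2, ?_⟩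
    unfold SRPTCondition at hs
    push Not at hs
    obtain ⟨i, hi, hlt⟩ := hs c hc
    rw [div_mul_eq_mul_div, div_lt_iff₀ hα0] at hlt
    nlinarith [hmem.2 i hi]

/-- The machine does not idle while a job is available. -/
lemma RuleAt.sum_rate_eq_one (h : S.RuleAt α u) {j : J} (hj : j ∈ S.available u) :
    ∑ i, S.rate i u = 1 := by
  classical
  by_cases hs : S.SRPTCondition α u
  · obtain ⟨k, hk, hk1, hk0⟩ := h.1 hs
    rw [Finset.sum_eq_single k (fun i _ hi => hk0 i hi) (by simp), hk1]
  · obtain ⟨h1, h0⟩ := h.2 hs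
    -- With no nonclairvoyant job, any clairvoyant one satisfies the SRPT condition vacuously.
    have hN : (S.nonclairvoyant α u).Nonempty := by
      rcases le_or_gt (S.y j u) (α * I.p j) with hle | hlt
      · exact ⟨j, hj, hle⟩
      · by_contra hemp
        rw [Set.not_nonempty_iff_eq_empty] at hemp
        exact hs ⟨j, ⟨hj, hlt⟩, by simp [hemp]⟩
    obtain ⟨k, hk, hkmin⟩ :=
      Set.exists_min_image _ (fun i => S.y i u) (Set.toFinite _) hN
    have hkm : k ∈ S.setfJobs α u := ⟨hk, hkmin⟩
    have hfin : (S.setfJobs α u).Finite := Set.toFinite _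
    have hsum : ∑ i, S.rate i u = ∑ i ∈ hfin.toFinset, S.rate i u := by
      symm
      apply Finset.sum_subset (Finset.subset_univ _)
      intro i _ hi
      exact h0 i (by simpa using hi)
    rw [hsum, Finset.sum_congr rfl fun i hi => h1 i (by simpa using hi), Finset.sum_const,
      nsmul_eq_mul, ← Set.ncard_eq_toFinset_card _ hfin, mul_one_div_cancel]
    have : 0 < (S.setfJobs α u).ncard := (Set.ncard_pos hfin).2 ⟨k, hkm⟩
    exact_mod_cast this.ne'

end Rule

/-! ### The window in which a clairvoyant job waits -/

section Window

variable {S} {α : ℝ}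

lemma y_pos_of_clairvoyant (hα0 : 0 < α) {t : ℝ} {c : J} (hc : c ∈ S.clairvoyant α t) :
    0 < S.y c t :=
  (mul_pos hα0 (I.p_pos c)).trans hc.2

/-- While the clairvoyant job `c` waits, jobs of larger remaining processing time wait as well,
provided that they are clairvoyant or have been processed long enough. -/
lemma y_eq_of_remaining_lt (hα0 : 0 < α) (hα1 : α < 1) (hS : S.FollowsAlgorithm α) {t v : ℝ}
    {c j : J} (hc : c ∈ S.clairvoyant α t) (hvt : v ≤ t) (hv : S.y c v = S.y c t)
    (hrem : S.remaining c t < S.remaining j v)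
    (hy : α * I.p j < S.y j v ∨ α * S.remaining c t < (1 - α) * S.y j v) :
    S.y j t = S.y j v := by
  have hc' := S.mem_clairvoyant_iff.1 hc
  -- Below this level `j` has more remaining time than `c`, which excludes SRPT on `j`; `hy`
  -- persists in time and excludes the other rule.
  refine S.y_eq_of_ae_rate_eq_zero_of_lt (L := I.p j - S.remaining c t) hvt ?_ ?_
  · unfold remaining at hrem ⊢
    linarith
  filter_upwards [hS] with u (hu : S.RuleAt α u) hvu hut hL
  by_contra h0
  have hyc : S.y c u = S.y c t :=
    le_antisymm (S.monotone_y c hut) (hv ▸ S.monotone_y c hvu.le)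
  have hcu : c ∈ S.clairvoyant α u := by
    rw [mem_clairvoyant_iff, hyc]
    refine ⟨⟨(S.release_lt_of_y_pos ?_).le, hc'.1.2⟩, hc'.2⟩
    rw [hyc]
    exact y_pos_of_clairvoyant hα0 hc
  have hmono := S.monotone_y j hvu.le
  have hremc : S.remaining c u = S.remaining c t := by simp [remaining, hyc]
  rcases hu.of_rate_pos hα0 hα1 hcu (lt_of_le_of_ne (S.rate_nonneg j u) (Ne.symm h0)) with
    h | ⟨h1, h2⟩
  · rw [hremc, remaining] at h
    linarith
  · rw [hremc] at h2
    rcases hy with hy | hy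
    · linarith
    · nlinarith

/-- A job that is released while the clairvoyant job `c` waits receives only a bounded amount of
processing. -/
lemma y_mul_le_remaining (hα0 : 0 < α) (hα1 : α < 1) (hS : S.FollowsAlgorithm α) {t τ : ℝ}
    {c j : J} (hc : c ∈ S.clairvoyant α t) (hτt : τ ≤ t) (hτ : S.y c τ = S.y c t)
    (hj : τ ≤ I.r j) : (1 - α) * S.y j t ≤ S.remaining c t := by
  by_contra! hlt
  have hα : 0 < 1 - α := by linarith
  have hx : 0 < S.remaining c t := by
    have := (S.mem_clairvoyant_iff.1 hc).1.2
    unfold remaining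
    linarith
  set x := S.remaining c t with hxdef
  -- The bound splits as `x / (1 - α) = α x / (1 - α) + x`. The level `ℓ` lies just above the first
  -- summand, with `x + ℓ` still below `y j t`; at this level `j` freezes, as more than `x` remains.
  obtain ⟨ℓ, hℓ1, hℓ2⟩ : ∃ ℓ, α * x < (1 - α) * ℓ ∧ (1 - α) * ℓ < α * x + (1 - α) *
      (((1 - α) * S.y j t) - x) := by
    obtain ⟨z, hz1, hz2⟩ := exists_between
      (show α * x < α * x + (1 - α) * (((1 - α) * S.y j t) - x) by
        have := mul_pos hα (sub_pos.2 hlt)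
        linarith)
    refine ⟨z / (1 - α), ?_⟩
    rw [mul_div_cancel₀ _ hα.ne']
    exact ⟨hz1, hz2⟩
  have hp := S.y_le j t
  have hℓ0 : 0 ≤ ℓ := by
    by_contra! hneg
    nlinarith
  have hyx : x < S.y j t := by nlinarith
  have hℓx : x + ℓ < S.y j t := by
    have : (1 - α) * (x + ℓ) < (1 - α) * S.y j t := by nlinarith
    exact lt_of_mul_lt_mul_left this hα.le
  obtain ⟨v, hv, hvℓ⟩ := intermediate_value_Icc hτt (S.continuous_y j).continuousOn
    (show ℓ ∈ Set.Icc (S.y j τ) (S.y j t) by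
      rw [S.y_eq_zero hj]
      exact ⟨hℓ0, by linarith⟩)
  have hyc : S.y c v = S.y c t :=
    le_antisymm (S.monotone_y c hv.2) (hτ ▸ S.monotone_y c hv.1)
  have := y_eq_of_remaining_lt hα0 hα1 hS (j := j) hc hv.2 hyc
    (by rw [← hxdef, remaining, hvℓ]; linarith) (Or.inr (by rw [hvℓ]; exact hℓ1))
  linarith

/-- Of two clairvoyant jobs, the one of larger remaining processing time waits. -/
lemma y_eq_of_both_clairvoyant (hα0 : 0 < α) (hα1 : α < 1) (hS : S.FollowsAlgorithm α)
    {a b : ℝ} (hab : a ≤ b) {c j : J} (hc : ∀ u, a ≤ u → u ≤ b → c ∈ S.clairvoyant α u)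
    (hj : α * I.p j < S.y j a) (hlt : S.remaining c a < S.remaining j a) :
    S.y j b = S.y j a := by
  refine S.y_eq_of_ae_rate_eq_zero_of_lt (L := I.p j - S.remaining c a) hab ?_ ?_
  · unfold remaining at hlt ⊢
    linarith
  filter_upwards [hS] with u (hu : S.RuleAt α u) hau hub hL
  by_contra h0
  have hmono := S.monotone_y c hau.le
  have hmonoj := S.monotone_y j hau.le
  rcases hu.of_rate_pos hα0 hα1 (hc u hau.le hub)
    (lt_of_le_of_ne (S.rate_nonneg j u) (Ne.symm h0)) with h | ⟨h, -⟩
  · unfold remaining at h hL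
    linarith
  · linarith

/-- When a clairvoyant job `c` has just been processed, all other clairvoyant jobs have a strictly
larger remaining processing time. -/
lemma remaining_lt_of_clairvoyant (hα0 : 0 < α) (hα1 : α < 1) (hS : S.FollowsAlgorithm α)
    {τ : ℝ} {c j : J} (hne : j ≠ c) (hc : c ∈ S.clairvoyant α τ) (hj : j ∈ S.clairvoyant α τ)
    (hτ : ∀ u < τ, S.y c u < S.y c τ) :
    S.remaining c τ < S.remaining j τ := by
  have hcl : ∀ i ∈ S.clairvoyant α τ, ∃ a < τ, ∀ u, a ≤ u → u ≤ τ → i ∈ S.clairvoyant α u := by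
    intro i hi
    have hi' := S.mem_clairvoyant_iff.1 hi
    obtain ⟨ε, hε, hball⟩ := Metric.eventually_nhds_iff.1
      ((continuousAt_const (y := α * I.p i)).eventually_lt
        (S.continuous_y i).continuousAt hi'.2)
    refine ⟨τ - ε / 2, by linarith, fun u hau hut => ?_⟩
    have hyu : α * I.p i < S.y i u := by
      apply hball
      rw [Real.dist_eq, abs_lt]
      constructor <;> linarith
    rw [mem_clairvoyant_iff]
    exact ⟨⟨(S.release_lt_of_y_pos ((mul_pos hα0 (I.p_pos i)).trans hyu)).le,
      (S.monotone_y i hut).trans_lt hi'.1.2⟩, hyu⟩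
  obtain ⟨a₁, ha₁, hca⟩ := hcl c hc
  obtain ⟨a₂, ha₂, hja⟩ := hcl j hj
  set a := max a₁ a₂ with ha
  have haτ : a < τ := max_lt ha₁ ha₂
  have hcu : ∀ u, a ≤ u → u ≤ τ → c ∈ S.clairvoyant α u :=
    fun u h => hca u ((le_max_left _ _).trans h)
  have hju : ∀ u, a ≤ u → u ≤ τ → j ∈ S.clairvoyant α u :=
    fun u h => hja u ((le_max_right _ _).trans h)
  by_contra! hle
  -- A job with larger remaining time would be frozen until `τ`: for `j` this contradicts `hle`, for
  -- `c` it contradicts `hτ`.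
  have heq : ∀ u, a ≤ u → u < τ → S.remaining c u = S.remaining j u := by
    intro u hau hut
    rcases lt_trichotomy (S.remaining c u) (S.remaining j u) with h | h | h
    · have h1 := y_eq_of_both_clairvoyant hα0 hα1 hS hut.le
        (fun w hw => hcu w (hau.trans hw)) (hju u hau hut.le).2 h
      have h2 := S.monotone_y c hut.le
      unfold remaining at h hle
      linarith
    · exact h
    · have h1 := y_eq_of_both_clairvoyant hα0 hα1 hS hut.le
        (fun w hw => hju w (hau.trans hw)) (hcu u hau hut.le).2 h
      exact absurd h1 (hτ u hut).ne'
  obtain ⟨u, hau, hut, hpos, hu, hdc, hdj⟩ := S.exists_rate_pos haτ.le (hτ a haτ)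
    (Q := fun u => S.RuleAt α u ∧ HasDerivAt (S.y c) (S.rate c u) u ∧
      HasDerivAt (S.y j) (S.rate j u) u) (by
    filter_upwards [hS, LocallyIntegrable.ae_hasDerivAt_integral (S.locallyIntegrable_rate c),
      LocallyIntegrable.ae_hasDerivAt_integral (S.locallyIntegrable_rate j)] with u h1 h2 h3
    exact ⟨h1, h2 0, h3 0⟩)
  obtain ⟨hone, hzero, -⟩ := hu.of_clairvoyant_rate_pos hα0 (hcu u hau.le hut.le).2 hpos
  have hconst : (fun w => S.y c w - S.y j w) =ᶠ[nhds u] fun _ => I.p c - I.p j := by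
    filter_upwards [Ioo_mem_nhds hau hut] with w hw
    have := heq w hw.1.le hw.2
    unfold remaining at this
    linarith
  -- Equal remaining times force equal rates, but the rates here are 1 and 0.
  have := (hdc.sub hdj).unique ((hasDerivAt_const u _).congr_of_eventuallyEq hconst)
  rw [hone, hzero j hne] at this
  norm_num at this

/-- After the clairvoyant job `c` has been processed for the last time before `t`, no job that had
been released earlier is processed until `t`. -/
lemma y_eq_of_release_lt (hα0 : 0 < α) (hα1 : α < 1) (hS : S.FollowsAlgorithm α) {t : ℝ}
    {c j : J} (hc : c ∈ S.clairvoyant α t) (hne : j ≠ c) (hj : I.r j < S.lastProcessed t c)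
    (hfin : S.y j (S.lastProcessed t c) < I.p j) :
    S.y j t = S.y j (S.lastProcessed t c) ∧ S.remaining c t < S.remaining j t := by
  obtain ⟨hτt, hτ, hmin⟩ := S.lastProcessed_spec (y_pos_of_clairvoyant hα0 hc)
  set τ := S.lastProcessed t c
  have hc' := S.mem_clairvoyant_iff.1 hc
  have hcτ : c ∈ S.clairvoyant α τ := by
    rw [mem_clairvoyant_iff, hτ]
    refine ⟨⟨(S.release_lt_of_y_pos ?_).le, hc'.1.2⟩, hc'.2⟩
    rw [hτ]
    exact y_pos_of_clairvoyant hα0 hc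
  have hremc : S.remaining c τ = S.remaining c t := by simp [remaining, hτ]
  have key : S.remaining c t < S.remaining j τ ∧
      (α * I.p j < S.y j τ ∨ α * S.remaining c t < (1 - α) * S.y j τ) := by
    rcases lt_or_ge (α * I.p j) (S.y j τ) with h | h
    · refine ⟨?_, Or.inl h⟩
      rw [← hremc]
      exact remaining_lt_of_clairvoyant hα0 hα1 hS hne hcτ
        (S.mem_clairvoyant_iff.2 ⟨⟨hj.le, hfin⟩, h⟩) (fun u hu => hτ ▸ hmin u hu)
    -- If `j` is still nonclairvoyant, take a moment just before `τ` at which `c` runs. The SRPT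
    -- condition there compares `c` with `j`, and is strict for the smaller final remaining time of
    -- `c`.
    · obtain ⟨a, ha, hca⟩ : ∃ a < τ, ∀ u, a ≤ u → α * I.p c < S.y c u := by
        obtain ⟨ε, hε, hball⟩ := Metric.eventually_nhds_iff.1
          ((continuousAt_const (y := α * I.p c)).eventually_lt
            (S.continuous_y c).continuousAt hcτ.2)
        refine ⟨τ - ε / 2, by linarith, fun u hu => ?_⟩
        refine lt_of_lt_of_le (hball ?_) (S.monotone_y c hu)
        rw [Real.dist_eq, abs_lt]
        constructor <;> linarith
      have hbτ : max a (I.r j) < τ := max_lt ha hj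
      obtain ⟨u, hau, hut, hpos, hu⟩ := S.exists_rate_pos hbτ.le
        (hτ ▸ hmin _ hbτ) (Q := S.RuleAt α) hS
      have hjN : j ∈ S.nonclairvoyant α u := by
        have hm := S.monotone_y j hut.le
        rw [mem_nonclairvoyant_iff]
        exact ⟨⟨(le_max_right _ _).trans hau.le, hm.trans_lt hfin⟩, hm.trans h⟩
      have h1 := (hu.of_clairvoyant_rate_pos hα0 (hca u ((le_max_left _ _).trans hau.le))
        hpos).2.2 j hjN
      have h2 : S.remaining c t < S.remaining c u := by
        have := hmin u hut
        unfold remaining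
        linarith
      have h3 : α * S.remaining c t < (1 - α) * S.y j τ := by
        have := mul_lt_mul_of_pos_left h2 hα0
        have := mul_le_mul_of_nonneg_left (S.monotone_y j hut.le) (by linarith : 0 ≤ 1 - α)
        linarith
      refine ⟨?_, Or.inr h3⟩
      have h4 : (1 - α) * S.y j τ ≤ α * ((1 - α) * I.p j) := by
        have := mul_le_mul_of_nonneg_left h (by linarith : 0 ≤ 1 - α)
        linarith
      have h5 := lt_of_mul_lt_mul_left (h3.trans_le h4) hα0.le
      simp only [remaining] at h5 ⊢
      linarith
  have h1 := y_eq_of_remaining_lt hα0 hα1 hS hc hτt hτ key.1 key.2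
  refine ⟨h1, ?_⟩
  have := key.1
  unfold remaining at this ⊢
  rwa [h1]

end Window

/-! ### Volume comparison with another schedule -/

section Volume

variable {S} {α : ℝ}

/-- On jobs of `W` finished by `S'`, what remains in `S` is exactly the lead of `S'`; the lead of
`S` on the other jobs of `W` must compensate for it. -/
lemma sum_remaining_le_of_sum_y_le (S' : Schedule I) {t : ℝ} [DecidablePred (· ∈ S'.available t)]
    {W D : Finset J} (hW : ∀ j ∈ W, I.r j ≤ t) (h : ∑ j ∈ W, S'.y j t ≤ ∑ j ∈ W, S.y j t)
    (hDW : D ⊆ W) (hD : ∀ d ∈ D, d ∉ S'.available t) :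
    ∑ d ∈ D, S.remaining d t ≤ ∑ j ∈ W with j ∈ S'.available t, S.y j t := by
  have hD' : D ⊆ W.filter (· ∉ S'.available t) :=
    fun d hd => Finset.mem_filter.2 ⟨hDW hd, hD d hd⟩
  have h1 : ∑ d ∈ D, S.remaining d t ≤ ∑ d ∈ W with d ∉ S'.available t, S.remaining d t :=
    Finset.sum_le_sum_of_subset_of_nonneg hD' fun d _ _ => sub_nonneg.2 (S.y_le d t)
  have h2 : ∑ d ∈ W with d ∉ S'.available t, S.remaining d t =
      ∑ d ∈ W with d ∉ S'.available t, S'.y d t - ∑ d ∈ W with d ∉ S'.available t, S.y d t := by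
    rw [← Finset.sum_sub_distrib]
    refine Finset.sum_congr rfl fun d hd => ?_
    obtain ⟨hdW, hd⟩ := Finset.mem_filter.1 hd
    rw [mem_available_iff, not_and, not_lt] at hd
    rw [remaining, le_antisymm (S'.y_le d t) (hd (hW d hdW))]
  have h3 := Finset.sum_filter_add_sum_filter_not W (· ∈ S'.available t) (fun j => S.y j t)
  have h4 := Finset.sum_filter_add_sum_filter_not W (· ∈ S'.available t) (fun j => S'.y j t)
  have h5 : 0 ≤ ∑ j ∈ W with j ∈ S'.available t, S'.y j t :=
    Finset.sum_nonneg fun j _ => S'.y_nonneg j t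
  linarith

/-- The volume comparison with another schedule from the time on at which the clairvoyant job `c`
has been processed for the last time. -/
lemma sum_remaining_le_window (hα0 : 0 < α) (hα1 : α < 1) (hS : S.FollowsAlgorithm α)
    (S' : Schedule I) {t : ℝ} [DecidablePred (· ∈ S'.available t)] {c : J}
    (hc : c ∈ S.clairvoyant α t) {D : Finset J}
    (hD : ∀ d ∈ D, S.lastProcessed t c ≤ I.r d ∧ I.r d ≤ t ∧ d ∉ S'.available t) :
    ∑ d ∈ D, S.remaining d t ≤
      ∑ j with S.lastProcessed t c ≤ I.r j ∧ j ∈ S'.available t, S.y j t := by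
  obtain ⟨hτt, hτ, -⟩ := S.lastProcessed_spec (y_pos_of_clairvoyant hα0 hc)
  set τ := S.lastProcessed t c with hτdef
  have hc' := S.mem_clairvoyant_iff.1 hc
  set W : Finset J := {j | τ ≤ I.r j ∧ I.r j ≤ t} with hWdef
  have hbusy : ∑ j, (S.y j t - S.y j τ) = t - τ := by
    apply S.sum_y_sub_eq hτt
    filter_upwards [hS] with u (hu : S.RuleAt α u) hτu hut
    have hyc : S.y c u = S.y c t :=
      le_antisymm (S.monotone_y c hut) (hτ ▸ S.monotone_y c hτu.le)
    refine hu.sum_rate_eq_one (j := c) (S.mem_available_iff.2 ⟨?_, hyc ▸ hc'.1.2⟩)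
    exact (S.release_lt_of_y_pos (hyc ▸ y_pos_of_clairvoyant hα0 hc)).le
  have hsub : ∑ j ∈ W, S.y j t = ∑ j, (S.y j t - S.y j τ) := by
    have : ∑ j ∈ W, S.y j t = ∑ j ∈ W, (S.y j t - S.y j τ) := by
      refine Finset.sum_congr rfl fun j hj => ?_
      rw [S.y_eq_zero (Finset.mem_filter.1 hj).2.1, sub_zero]
    rw [this]
    apply Finset.sum_subset (Finset.subset_univ _)
    intro j _ hj
    have hj' : τ ≤ I.r j → t < I.r j := by simpa [hWdef] using hj
    rcases le_or_gt τ (I.r j) with h | h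
    · rw [S.y_eq_zero h, S.y_eq_zero (hj' h).le, sub_zero]
    · rw [sub_eq_zero]
      by_cases hjc : j = c
      · rw [hjc, hτ]
      rcases (S.y_le j τ).lt_or_eq with hlt | heq
      · exact (y_eq_of_release_lt hα0 hα1 hS hc hjc h hlt).1
      · exact le_antisymm (heq ▸ S.y_le j t) (S.monotone_y j hτt)
  have hle : ∑ j ∈ W, S'.y j t ≤ ∑ j ∈ W, S.y j t := by
    have h1 := S'.sum_y_sub_le hτt W
    have h2 : ∑ j ∈ W, (S'.y j t - S'.y j τ) = ∑ j ∈ W, S'.y j t := by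
      refine Finset.sum_congr rfl fun j hj => ?_
      rw [S'.y_eq_zero (Finset.mem_filter.1 hj).2.1, sub_zero]
    linarith
  refine (sum_remaining_le_of_sum_y_le S' (W := W) (fun j hj => (Finset.mem_filter.1 hj).2.2) hle
    (fun d hd => ?_) fun d hd => (hD d hd).2.2).trans_eq ?_
  · simpa [hWdef] using ⟨(hD d hd).1, (hD d hd).2.1⟩
  · refine Finset.sum_congr ?_ fun _ _ => rfl
    ext j
    simp only [hWdef, Finset.mem_filter, Finset.mem_univ, true_and, mem_available_iff]
    tauto

/-- The algorithm never idles unnecessarily, so no schedule has done more work at any time. -/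
lemma sum_y_le_sum_y (hS : S.FollowsAlgorithm α) (S' : Schedule I) (t : ℝ) :
    ∑ j, S'.y j t ≤ ∑ j, S.y j t := by
  by_contra! hlt
  have ht : 0 ≤ t := by
    by_contra! hneg
    have h0 : ∀ (T : Schedule I), ∑ j, T.y j t = 0 := fun T =>
      Finset.sum_eq_zero fun j _ => T.y_eq_zero (hneg.le.trans (I.r_nonneg j))
    rw [h0, h0] at hlt
    exact lt_irrefl _ hlt
  set K : Set ℝ := {u | u ∈ Set.Icc 0 t ∧ ∑ j, S'.y j u ≤ ∑ j, S.y j u} with hK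
  have hKcl : IsClosed K :=
    isClosed_Icc.inter (isClosed_le (continuous_finsetSum _ fun j _ => S'.continuous_y j)
      (continuous_finsetSum _ fun j _ => S.continuous_y j))
  have hKbdd : BddAbove K := ⟨t, fun u hu => hu.1.2⟩
  have h0K : (0 : ℝ) ∈ K := ⟨⟨le_rfl, ht⟩, by simp [y]⟩
  have hv : sSup K ∈ K := hKcl.csSup_mem ⟨0, h0K⟩ hKbdd
  -- After this last time at which `S` is not behind, some released job has received less in `S`
  -- than in `S'`. It is available in `S`, so `S` works at full rate and cannot fall behind.
  set v := sSup K
  have hbusy : ∑ j, (S.y j t - S.y j v) = t - v := by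
    apply S.sum_y_sub_eq hv.1.2
    filter_upwards [hS] with u (hu : S.RuleAt α u) hvu hut
    have hu' : ∑ j, S.y j u < ∑ j, S'.y j u := by
      by_contra! hle
      exact hvu.not_ge (le_csSup hKbdd ⟨⟨hv.1.1.trans hvu.le, hut⟩, hle⟩)
    obtain ⟨j, -, hj⟩ := Finset.exists_lt_of_sum_lt hu'
    exact hu.sum_rate_eq_one (j := j) (S.mem_available_iff.2
      ⟨(S'.release_lt_of_y_pos ((S.y_nonneg j u).trans_lt hj)).le, hj.trans_le (S'.y_le j u)⟩)
  have h1 := S'.sum_y_sub_le hv.1.2 Finset.univ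
  rw [Finset.sum_sub_distrib] at h1 hbusy
  linarith [hv.2]

/-- The same comparison with all released jobs in place of a window, used for the whole of `D`. -/
lemma sum_remaining_le (hS : S.FollowsAlgorithm α) (S' : Schedule I) {t : ℝ}
    [DecidablePred (· ∈ S'.available t)] {D : Finset J}
    (hD : ∀ d ∈ D, I.r d ≤ t ∧ d ∉ S'.available t) :
    ∑ d ∈ D, S.remaining d t ≤ ∑ j with j ∈ S'.available t, S.y j t := by
  set W : Finset J := {j | I.r j ≤ t} with hWdef
  have hsum : ∀ T : Schedule I, ∑ j ∈ W, T.y j t = ∑ j, T.y j t := fun T => by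
    apply Finset.sum_subset (Finset.subset_univ _)
    intro j _ hj
    have hj' : t < I.r j := by simpa [hWdef] using hj
    exact T.y_eq_zero hj'.le
  refine (sum_remaining_le_of_sum_y_le S' (W := W) (fun j hj => (Finset.mem_filter.1 hj).2)
    (by rw [hsum, hsum]; exact sum_y_le_sum_y hS S' t)
    (fun d hd => ?_) fun d hd => (hD d hd).2).trans_eq ?_
  · simpa [hWdef] using (hD d hd).1
  · refine Finset.sum_congr ?_ fun _ _ => rfl
    ext j
    simp only [hWdef, Finset.mem_filter, Finset.mem_univ, true_and, mem_available_iff]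
    tauto

end Volume

end Schedule

/-! ### Counting by charging -/

/-- Weighted prefix sums that are nonnegative stay so after dividing by nondecreasing weights. -/
lemma sum_range_nonneg_of_weighted {R v : ℕ → ℝ} {m : ℕ} (hR : ∀ k < m, 0 < R k)
    (hmono : ∀ k, k + 1 < m → R k ≤ R (k + 1))
    (hsum : ∀ k ≤ m, 0 ≤ ∑ l ∈ Finset.range k, v l * R l) : 0 ≤ ∑ l ∈ Finset.range m, v l := by
  -- Once a prefix sum of `v` is known to be nonnegative, its factor `R k` may be raised to `R (k +
  -- 1)`.
  have key : ∀ k, k < m →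
      ∑ l ∈ Finset.range (k + 1), v l * R l ≤ (∑ l ∈ Finset.range (k + 1), v l) * R k := by
    intro k
    induction k with
    | zero => intro _; simp
    | succ k ih =>
      intro hk
      have h1 := ih (by omega)
      have h2 := hsum (k + 1) (by omega)
      have h3 : 0 ≤ ∑ l ∈ Finset.range (k + 1), v l :=
        nonneg_of_mul_nonneg_left (h2.trans h1) (hR k (by omega))
      rw [Finset.sum_range_succ, Finset.sum_range_succ _ (k + 1), add_mul]
      have := mul_le_mul_of_nonneg_left (hmono k hk) h3
      linarith
  rcases m with - | m
  · simp
  · exact nonneg_of_mul_nonneg_left ((hsum (m + 1) le_rfl).trans (key m (by omega)))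
      (hR m (by omega))

/-- Counting by charging: each of `m` items of increasing sizes `R k` is charged either to an
element that enters the chain `V` right after it, or to the volume `y` of the elements of `V`. -/
lemma le_mul_card_of_chain {J : Type*} [DecidableEq J] {m : ℕ} {R : ℕ → ℝ} {V : ℕ → Finset J}
    {y : J → ℝ} {κ : ℝ} (hκ : 0 ≤ κ) (hR : ∀ k < m, 0 < R k)
    (hmono : ∀ k, k + 1 < m → R k ≤ R (k + 1)) (hV : ∀ k < m, V k ⊆ V (k + 1))
    (hy : ∀ k < m, ∀ j ∈ V k, y j ≤ κ * R k)
    (hsum : ∀ k < m, ∑ l ∈ Finset.range (k + 1), R l ≤ ∑ j ∈ V (k + 1), y j) :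
    (m : ℝ) ≤ (1 + κ) * (V m).card := by
  -- The shift makes `n (l + 1) - n l` the number of elements entering at `V l`, with all of `V 0`
  -- counted at `l = 0`.
  set n : ℕ → ℝ := fun k => if k = 0 then 0 else ((V (k - 1)).card : ℝ) with hn
  have hn_succ : ∀ k, n (k + 1) = ((V k).card : ℝ) := fun k => by simp [hn]
  have hn_mono : ∀ k < m, n k ≤ n (k + 1) := by
    intro k hk
    rcases k with - | k
    · simp [hn]
    · rw [hn_succ, hn_succ]
      exact_mod_cast Finset.card_le_card (hV k (by omega))
  -- Marks the items after which no element enters; these are charged to volume.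
  set a : ℕ → ℝ := fun k => if V (k + 1) = V k then 1 else 0 with ha
  have ha_le : ∀ k, a k ≤ 1 := fun k => by
    simp only [ha]
    split_ifs <;> norm_num
  -- An element is bounded by `κ * R l` for the first `V l` containing it.
  have hvol : ∀ k < m, ∑ j ∈ V k, y j ≤
      κ * ∑ l ∈ Finset.range (k + 1), (n (l + 1) - n l) * R l := by
    intro k
    induction k with
    | zero =>
      intro hk
      have := Finset.sum_le_card_nsmul (V 0) y _ (hy 0 hk)
      simp only [nsmul_eq_mul] at this
      simp only [zero_add, Finset.sum_range_one, hn_succ]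
      simp only [hn, if_true, sub_zero]
      linarith
    | succ k ih =>
      intro hk
      have h1 := ih (by omega)
      have hsub := hV k (by omega)
      have h2 := Finset.sum_le_card_nsmul (V (k + 1) \ V k) y _
        fun j hj => hy (k + 1) hk j (Finset.mem_sdiff.1 hj).1
      have h3 := Finset.sum_sdiff (f := y) hsub
      have h4 : (((V (k + 1) \ V k).card : ℕ) : ℝ) = n (k + 2) - n (k + 1) := by
        rw [hn_succ, hn_succ, Finset.card_sdiff_of_subset hsub,
          Nat.cast_sub (Finset.card_le_card hsub)]
      rw [nsmul_eq_mul, h4] at h2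
      rw [Finset.sum_range_succ]
      linarith
  -- At a marked item the volume bounds give the inequality directly; at an unmarked one the added
  -- term is nonnegative.
  have hweighted : ∀ k ≤ m,
      0 ≤ ∑ l ∈ Finset.range k, (κ * (n (l + 1) - n l) - a l) * R l := by
    intro k
    induction k with
    | zero => simp
    | succ k ih =>
      intro hk
      by_cases hVk : V (k + 1) = V k
      · have h1 := hvol k (by omega)
        have h2 := hsum k (by omega)
        rw [hVk] at h2
        have h3 : ∑ l ∈ Finset.range (k + 1), a l * R l ≤ ∑ l ∈ Finset.range (k + 1), R l := by
          refine Finset.sum_le_sum fun l hl => ?_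
          have := hR l (by have := Finset.mem_range.1 hl; omega)
          nlinarith [ha_le l]
        have h4 : ∑ l ∈ Finset.range (k + 1), (κ * (n (l + 1) - n l) - a l) * R l =
            κ * ∑ l ∈ Finset.range (k + 1), (n (l + 1) - n l) * R l -
              ∑ l ∈ Finset.range (k + 1), a l * R l := by
          rw [Finset.mul_sum, ← Finset.sum_sub_distrib]
          exact Finset.sum_congr rfl fun l _ => by ring
        linarith
      · rw [Finset.sum_range_succ]
        have h1 : a k = 0 := by simp [ha, hVk]
        have h2 := mul_nonneg (mul_nonneg hκ (sub_nonneg.2 (hn_mono k (by omega))))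
          (hR k (by omega)).le
        rw [h1, sub_zero]
        exact add_nonneg (ih (by omega)) h2
  have hmain := sum_range_nonneg_of_weighted hR hmono hweighted
  rw [Finset.sum_sub_distrib, ← Finset.mul_sum, Finset.sum_range_sub] at hmain
  have hcharge : ∀ k ≤ m, (k : ℝ) - ∑ l ∈ Finset.range k, a l ≤ ((V k).card : ℝ) := by
    intro k
    induction k with
    | zero => simp
    | succ k ih =>
      intro hk
      have h1 := ih (by omega)
      have hsub := hV k (by omega)
      rw [Finset.sum_range_succ]
      push_cast
      by_cases hVk : V (k + 1) = V k
      · have : a k = 1 := by simp [ha, hVk]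
        rw [hVk]
        linarith
      · have h2 : a k = 0 := by simp [ha, hVk]
        have h3 : ((V k).card : ℝ) + 1 ≤ ((V (k + 1)).card : ℝ) := by
          exact_mod_cast Finset.card_lt_card (hsub.ssubset_of_ne (Ne.symm hVk))
        linarith
  have hfinal := hcharge m le_rfl
  have hnm : n m ≤ ((V m).card : ℝ) := by
    rcases m with - | m
    · simp [hn]
    · rw [hn_succ]
      exact_mod_cast Finset.card_le_card (hV m (by omega))
  have hn0 : n 0 = 0 := by simp [hn]
  rw [hn0, sub_zero] at hmain
  have := mul_le_mul_of_nonneg_left hnm hκ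
  linarith

/-- A finite set on which `R` is injective can be enumerated by increasing values of `R`. -/
lemma exists_enumeration {J : Type*} [DecidableEq J] (D : Finset J) (R : J → ℝ)
    (hR : Set.InjOn R D) :
    ∃ e : Fin D.card → J, (∀ k, e k ∈ D) ∧ StrictMono (R ∘ e) := by
  have hcard : (D.image R).card = D.card := Finset.card_image_of_injOn hR
  have h : ∀ k, ∃ d ∈ D, R d = (D.image R).orderEmbOfFin hcard k := fun k => by
    exact Finset.mem_image.1 (Finset.orderEmbOfFin_mem (D.image R) hcard k)
  choose e he heR using h
  refine ⟨e, he, fun a b hab => ?_⟩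
  simp only [Function.comp, heR]
  exact (OrderEmbedding.strictMono _) hab

end FlowTime

/-! ### The main theorem -/

open FlowTime Schedule in
theorem mainTheorem5 {J : Type*} [Fintype J] (I : FlowTime.FlowInstance J)
    (α : ℝ) (hα0 : 0 < α) (hα1 : α < 1)
    (S : FlowTime.Schedule I) (hS : S.FollowsAlgorithm α)
    (Opt : FlowTime.Schedule I) (hOpt : Opt.IsOptimal) (t : ℝ) :
    ((S.clairvoyant α t \ Opt.available t).ncard : ℝ) ≤
      (1 + 1 / (1 - α)) * ((Opt.available t).ncard : ℝ) := by
  classical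
  have hα : 0 < 1 - α := by linarith
  set D : Finset J := (S.clairvoyant α t \ Opt.available t).toFinset with hDdef
  have hDC : ∀ {d}, d ∈ D → d ∈ S.clairvoyant α t := fun {d} hd => (Set.mem_toFinset.1 hd).1
  have hDO : ∀ {d}, d ∈ D → d ∉ Opt.available t := fun {d} hd => (Set.mem_toFinset.1 hd).2
  set O : Finset J := {j | j ∈ Opt.available t} with hOdef
  have hOcard : (Opt.available t).ncard = O.card := by
    rw [Set.ncard_eq_toFinset_card']
    congr 1
    ext j
    simp [hOdef]
  rw [Set.ncard_eq_toFinset_card', hOcard, ← hDdef]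
  set R : J → ℝ := fun j => S.remaining j t with hRdef
  set τ : J → ℝ := S.lastProcessed t with hτdef
  have hspec : ∀ {c}, c ∈ D → τ c ≤ t ∧ S.y c (τ c) = S.y c t := fun hc =>
    have h := S.lastProcessed_spec (y_pos_of_clairvoyant hα0 (hDC hc))
    ⟨h.1, h.2.1⟩
  have hrτ : ∀ {c}, c ∈ D → I.r c < τ c := fun {c} hc => by
    apply S.release_lt_of_y_pos
    rw [(hspec hc).2]
    exact y_pos_of_clairvoyant hα0 (hDC hc)
  have hRpos : ∀ {c}, c ∈ D → 0 < R c := fun {c} hc =>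
    sub_pos.2 (S.mem_clairvoyant_iff.1 (hDC hc)).1.2
  have hrel : ∀ {c d}, c ∈ D → d ∈ D → d ≠ c → R d ≤ R c → τ c ≤ I.r d := by
    intro c d hc hd hne hle
    by_contra! hlt
    refine hle.not_gt (y_eq_of_release_lt hα0 hα1 hS (hDC hc) hne hlt ?_).2
    exact (S.monotone_y d (hspec hc).1).trans_lt (S.mem_clairvoyant_iff.1 (hDC hd)).1.2
  -- A tie would give `τ c ≤ r d < τ d ≤ r c < τ c`.
  have hinj : Set.InjOn R D := by
    intro c hc d hd heq
    by_contra hne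
    have h1 := hrel hc hd (Ne.symm hne) heq.ge
    have h2 := hrel hd hc hne heq.le
    linarith [hrτ hc, hrτ hd]
  obtain ⟨e, heD, hemono⟩ := exists_enumeration D R hinj
  -- The default value `O` supplies the last link of the chain, playing the role of a window
  -- containing all releases.
  set V : ℕ → Finset J := fun k =>
    if h : k < D.card then Finset.univ.filter fun j => τ (e ⟨k, h⟩) ≤ I.r j ∧ j ∈ Opt.available t
    else O with hVdef
  have hVm : V D.card = O := by simp [hVdef]
  have hVk : ∀ k (h : k < D.card),
      V k = ({j | τ (e ⟨k, h⟩) ≤ I.r j ∧ j ∈ Opt.available t} : Finset J) :=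
    fun k h => by simp [hVdef, h]
  set R' : ℕ → ℝ := fun k => if h : k < D.card then R (e ⟨k, h⟩) else 0 with hR'def
  have hR'k : ∀ k (h : k < D.card), R' k = R (e ⟨k, h⟩) := fun k h => by simp [hR'def, h]
  have hprefix : ∀ k (h : k < D.card), ∑ l ∈ Finset.range (k + 1), R' l =
      ∑ d ∈ (Finset.univ.filter fun i : Fin D.card => i.1 ≤ k).image e, R d := by
    intro k hk
    rw [Finset.sum_image fun a _ b _ hab => hemono.injective (congrArg R hab)]
    symm
    refine Finset.sum_bij (fun i _ => i.1) (fun i hi => ?_) (fun a _ b _ h => Fin.ext h)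
      (fun l hl => ?_) fun i _ => (hR'k i.1 i.2).symm
    · have := (Finset.mem_filter.1 hi).2
      exact Finset.mem_range.2 (by omega)
    · have := Finset.mem_range.1 hl
      exact ⟨⟨l, by omega⟩, by simp; omega, rfl⟩
  have hlt : ∀ {k l} (hk : k < D.card) (hl : l < D.card), k < l →
      R (e ⟨k, hk⟩) < R (e ⟨l, hl⟩) := fun hk hl hkl => hemono (Fin.mk_lt_mk.2 hkl)
  rw [← hVm]
  refine le_mul_card_of_chain (R := R') (y := fun j => S.y j t) (by positivity)
    (fun k hk => ?_) (fun k hk => ?_) (fun k hk => ?_) (fun k hk j hj => ?_) fun k hk => ?_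
  · rw [hR'k k hk]
    exact hRpos (heD _)
  · rw [hR'k k (by omega), hR'k (k + 1) hk]
    exact (hlt _ _ (Nat.lt_succ_self k)).le
  · intro j hj
    rw [hVk k hk] at hj
    obtain ⟨hj1, hj2⟩ := (Finset.mem_filter.1 hj).2
    by_cases hk' : k + 1 < D.card
    · rw [hVk _ hk']
      refine Finset.mem_filter.2 ⟨Finset.mem_univ _, ?_, hj2⟩
      have hR := hlt hk hk' (Nat.lt_succ_self k)
      have := hrel (heD ⟨k + 1, hk'⟩) (heD ⟨k, hk⟩) (fun h => hR.ne (congrArg R h)) hR.le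
      linarith [hrτ (heD ⟨k, hk⟩)]
    · simpa [hVdef, hk', hOdef] using hj2
  · rw [hVk k hk] at hj
    have := y_mul_le_remaining hα0 hα1 hS (hDC (heD ⟨k, hk⟩)) (hspec (heD _)).1 (hspec (heD _)).2
      (Finset.mem_filter.1 hj).2.1
    rw [hR'k k hk, one_div_mul_eq_div, le_div_iff₀ hα]
    linarith
  · rw [hprefix k hk]
    have himg : ∀ d ∈ (Finset.univ.filter fun i : Fin D.card => i.1 ≤ k).image e,
        ∃ i : Fin D.card, i.1 ≤ k ∧ e i = d := by
      intro d hd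
      simpa using hd
    -- The first `k + 1` jobs are all released in the window of the next one, hence the index shift;
    -- after the last job the global comparison takes over.
    by_cases hk' : k + 1 < D.card
    · rw [hVk _ hk']
      refine sum_remaining_le_window hα0 hα1 hS Opt (hDC (heD ⟨k + 1, hk'⟩)) fun d hd => ?_
      obtain ⟨i, hik, rfl⟩ := himg d hd
      have hR := hlt i.2 hk' (Nat.lt_succ_of_le hik)
      exact ⟨hrel (heD _) (heD i) (fun h => hR.ne (congrArg R h)) hR.le,
        (hDC (heD i)).1.1, hDO (heD i)⟩
    · have : V (k + 1) = O := by simp [hVdef, hk']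
      rw [this]
      refine sum_remaining_le hS Opt fun d hd => ?_
      obtain ⟨i, -, rfl⟩ := himg d hd
      exact ⟨(hDC (heD i)).1.1, hDO (heD i)⟩
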